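/- Let $I\subset\mathbb N$. For $J\subset I$ all series $\sum_{i\in J}$ of vectors are summed in the increasing order of the indices: $\sum_{i\in J}v_i=\lim_{N\to\infty}\sum_{i\in J,\,i<N}v_i$ (norm limit). A family $(v_i)_{i\in J}$ in a real Banach space $X$ is a (Schauder) basis of $X$ if every $x\in X$ has a unique expansion $x=\sum_{i\in J}a_iv_i$, $a_i\in\mathbb R$; then $v_i^*\in X^*$ denotes the functional $v_i^*(\sum_{j\in J}a_jv_j)=a_i$. The basis is - Besselian if convergence of $\sum a_iv_i$ implies $\sum a_i^2<\infty$, and Hilbertian if $\sum a_i^2<\infty$ implies convergence of $\sum a_iv_i$; - boundedly complete if $\sup_N\|\sum_{i\in J,\,i<N}a_iv_i\|<\infty$ implies convergence of $\sum a_iv_i$; - shrinking if $\overline{\operatorname{span}}(v_i^*,\ i\in J)=X^*$. Let $E$ be a real Banach space and $F$ a real Hilbert space with a Besselian and Hilbertian basis $(b_i)_{i\in I}$ ($I=\mathbb N$, or $I$ finite if $F$ is finite-dimensional). For $J\subset I$ let $$Y(J)=\Big\{(c_i)_{i\in J}\ :\ \sum_{i\in J}c_ib_i\text{ converges in }F\Big\},\qquad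 \|(c_i)\|_{Y(J)}=\sup_N\Big\|\sum_{i\in J,\,i<N}c_ib_i\Big\|.$$ Let $J_2\subset J_1\subset I$, let $U\subset E$ be open and let $f=(f_i)_{i\in J_1}:U\to Y(J_1)$ be of class $C^1$. Assume that the Constant Rank Condition Plus (CRC+) holds for $(f_i)_{i\in J_1}$ at $x_0$ with index set $J_2$ and a neighbourhood $V\subset U$ of $x_0$, that is, with $X_1:=\overline{\operatorname{span}}(Df_i(x_0),\ i\in J_1)\subset E^*$: 1. for every $x\in V$, $(Df_i(x))_{i\in J_2}$ is a basis of $\overline{\operatorname{span}}(Df_i(x),\ i\in J_1)$; 2. for every $x\in V$ there is a topological linear isomorphism $z_x:\overline{\operatorname{span}}(Df_i(x),\ i\in J_2)\to\overline{\operatorname{span}}(Df_i(x_0),\ i\in J_2)$ with $z_x(Df_i(x))=Df_i(x_0)$, $i\in J_2$; 3. $\{(Df_i(x_0)e)_{i\in J_2}\ :\ e\in E\}$ is closed in $Y(J_2)$; 4. the basis $(Df_i(x_0))_{i\in J_2}$ of $X_1$ is shrinking and boundedly complete; 5. the basis $(Df_i(x_0))_{i\in J_2}$ of $X_1$ is Besselian;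 6. $Df_i(x_0)^*\in E$ for $i\in J_2$, i.e. the functional $Df_i(x_0)^*$ on $X_1$ is the evaluation $\varphi\mapsto\varphi(e)$ at some $e\in E$. Then there are functions $h_l:Y(J_2)\to\mathbb R$, $l\in J_1\setminus J_2$, of class $C^1$, and a neighbourhood $W\subset U$ of $x_0$ such that for all $x\in W$ one has $(f_i(x))_{i\in J_2}\in Y(J_2)$ and $$f_l(x)=h_l\big((f_i(x))_{i\in J_2}\big)\qquad\text{for all } l\in J_1\setminus J_2 .$$ -/

import Mathlib

open Filter Topology

noncomputable section

namespace FunDep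

/-! ### Series indexed by a subset of `ℕ`, summed in the natural order -/

open Classical in
/-- The indices `i ∈ J` with `i < N`. -/
def initial (J : Set ℕ) (N : ℕ) : Finset J := Finset.subtype (· ∈ J) (Finset.range N)

/-- Summation over `J ⊆ ℕ` in the natural order: `HasSum f x (natOrder J)` says that the partial
sums `∑_{i ∈ J, i < N} f i` tend to `x` as `N → ∞`. -/
def natOrder (J : Set ℕ) : SummationFilter J := ⟨atTop.map (initial J)⟩

instance (J : Set ℕ) : (natOrder J).NeBot := ⟨inferInstanceAs (atTop.map (initial J)).NeBot⟩

theorem hasSum_natOrder_iff {J : Set ℕ} {X : Type*} [AddCommMonoid X] [TopologicalSpace X]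
    {f : J → X} {x : X} :
    HasSum f x (natOrder J) ↔ Tendsto (fun N => ∑ i ∈ initial J N, f i) atTop (𝓝 x) := by
  simp [HasSum, natOrder, Filter.tendsto_map'_iff, Function.comp_def]

/-! ### Schauder bases -/

section Bases

variable {J : Set ℕ} {X : Type*} [NormedAddCommGroup X] [NormedSpace ℝ X]

/-- `(v i)_{i ∈ J}` is a Schauder basis of `X`: every `x` has a unique expansion `∑ a i • v i`. -/
def IsSchauderBasis (v : J → X) : Prop :=
  ∀ x : X, ∃! a : J → ℝ, HasSum (fun i => a i • v i) x (natOrder J)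

/-- If `∑ a i • v i` converges then `∑ (a i)² < ∞`. -/
def IsBesselian (v : J → X) : Prop :=
  ∀ a : J → ℝ, Summable (fun i => a i • v i) (natOrder J) → Summable fun i => a i ^ 2

/-- If `∑ (a i)² < ∞` then `∑ a i • v i` converges. -/
def IsHilbertian (v : J → X) : Prop :=
  ∀ a : J → ℝ, (Summable fun i => a i ^ 2) → Summable (fun i => a i • v i) (natOrder J)

/-- If the partial sums of `∑ a i • v i` are bounded then the series converges. -/
def IsBoundedlyComplete (v : J → X) : Prop :=
  ∀ a : J → ℝ, (∃ C : ℝ, ∀ N, ‖∑ i ∈ initial J N, a i • v i‖ ≤ C) →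
    Summable (fun i => a i • v i) (natOrder J)

/-- `φ` is the `i`-th biorthogonal (coefficient) functional `v i ^*` of the basis `v`: it maps
`∑ a j • v j` to `a i`. -/
def IsCoeffFunctional (v : J → X) (i : J) (φ : StrongDual ℝ X) : Prop :=
  ∀ (x : X) (a : J → ℝ), HasSum (fun j => a j • v j) x (natOrder J) → φ x = a i

/-- The biorthogonal functionals of `v` have dense span in the dual of `X`. -/
def IsShrinking (v : J → X) : Prop :=
  (Submodule.span ℝ {φ : StrongDual ℝ X | ∃ i, IsCoeffFunctional v i φ}).topologicalClosure = ⊤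

/-- The closed linear span of a family. -/
def closedSpan {ι : Type*} (v : ι → X) : Submodule ℝ X :=
  (Submodule.span ℝ (Set.range v)).topologicalClosure

theorem mem_closedSpan {ι : Type*} (v : ι → X) (i : ι) : v i ∈ closedSpan v :=
  Submodule.le_topologicalClosure _ (Submodule.subset_span ⟨i, rfl⟩)

/-- The subfamily `(v i)_{i ∈ J₂}`, `J₂ ⊆ J₁`, as a family in the closed span of
`(v i)_{i ∈ J₁}`. -/
def subfamily {J₁ J₂ : Set ℕ} (v : J₁ → X) (h : J₂ ⊆ J₁) : J₂ → closedSpan v :=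
  fun i => ⟨v (Set.inclusion h i), mem_closedSpan v _⟩

end Bases

/-- A Schauder basis of `X` indexed, in the natural order, by a set `I ⊆ ℕ`
(`I = Set.univ` for an infinite-dimensional space, `I` finite for a finite-dimensional one). -/
structure OrderedBasis (I : Set ℕ) (X : Type*) [NormedAddCommGroup X] [NormedSpace ℝ X] where
  vec : I → X
  isSchauderBasis : IsSchauderBasis vec

/-! ### The coefficient space `Y(J)` -/

section CoeffSpace

variable {I : Set ℕ} {X : Type*} [NormedAddCommGroup X] [NormedSpace ℝ X]

theorem OrderedBasis.vec_ne_zero (b : OrderedBasis I X) (i : I) : b.vec i ≠ 0 := by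
  classical
  intro h
  obtain ⟨a, -, ha⟩ := b.isSchauderBasis 0
  have h0 : HasSum (fun j => (0 : I → ℝ) j • b.vec j) 0 (natOrder I) := by
    simp
  have h1 : HasSum (fun j => (Pi.single i 1 : I → ℝ) j • b.vec j) 0 (natOrder I) := by
    convert h0 using 2 with j
    by_cases hj : j = i
    · subst hj; simp [h]
    · simp [hj]
  have := congrFun ((ha _ h0).trans (ha _ h1).symm) i
  simp at this

/-- The scalar families `(c i)_{i ∈ J}` for which `∑_{i ∈ J} c i • b i` converges. -/
def coeffSubmodule {J : Set ℕ} (b : OrderedBasis I X) (hJ : J ⊆ I) : Submodule ℝ (J → ℝ) where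
  carrier := {c | ∃ x, HasSum (fun i => c i • b.vec (Set.inclusion hJ i)) x (natOrder J)}
  zero_mem' := ⟨0, by simp⟩
  add_mem' := by
    rintro c d ⟨x, hx⟩ ⟨y, hy⟩
    exact ⟨x + y, by simpa [add_smul] using hx.add hy⟩
  smul_mem' := by
    rintro r c ⟨x, hx⟩
    exact ⟨r • x, by simpa [mul_smul] using hx.const_smul r⟩

/-- The space `Y(J)` of all `(c i)_{i ∈ J}` for which `∑_{i ∈ J} c i • b i` converges. It is
a separate type so that it carries the norm below and not the product topology. -/
def Y {J : Set ℕ} (b : OrderedBasis I X) (hJ : J ⊆ I) : Type := coeffSubmodule b hJ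

namespace Y

variable {J : Set ℕ} (b : OrderedBasis I X) (hJ : J ⊆ I)

instance : AddCommGroup (Y b hJ) := inferInstanceAs (AddCommGroup (coeffSubmodule b hJ))

instance : Module ℝ (Y b hJ) := inferInstanceAs (Module ℝ (coeffSubmodule b hJ))

instance : CoeFun (Y b hJ) (fun _ => J → ℝ) := ⟨fun c => c.1⟩

variable {b hJ}

@[ext] theorem ext {c d : Y b hJ} (h : ∀ i, c i = d i) : c = d := Subtype.ext (funext h)

@[simp] theorem add_apply (c d : Y b hJ) (i : J) : (c + d) i = c i + d i := rfl

@[simp] theorem smul_apply (r : ℝ) (c : Y b hJ) (i : J) : (r • c) i = r * c i := rfl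

@[simp] theorem zero_apply (i : J) : (0 : Y b hJ) i = 0 := rfl

/-- The partial sum `∑_{i ∈ J, i < N} c i • b i`. -/
def partialSum (c : Y b hJ) (N : ℕ) : X :=
  ∑ i ∈ initial J N, c i • b.vec (Set.inclusion hJ i)

/-- The norm `sup_N ‖∑_{i ∈ J, i < N} c i • b i‖`. -/
instance : Norm (Y b hJ) := ⟨fun c => ⨆ N, ‖c.partialSum N‖⟩

theorem norm_def (c : Y b hJ) : ‖c‖ = ⨆ N, ‖c.partialSum N‖ := rfl

theorem partialSum_add (c d : Y b hJ) (N : ℕ) :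
    (c + d).partialSum N = c.partialSum N + d.partialSum N := by
  simp [partialSum, add_smul, Finset.sum_add_distrib]

theorem partialSum_smul (r : ℝ) (c : Y b hJ) (N : ℕ) :
    (r • c).partialSum N = r • c.partialSum N := by
  simp [partialSum, mul_smul, Finset.smul_sum]

theorem bddAbove_partialSum (c : Y b hJ) : BddAbove (Set.range fun N => ‖c.partialSum N‖) := by
  obtain ⟨x, hx⟩ := c.2
  exact (hasSum_natOrder_iff.1 hx).norm.bddAbove_range

theorem norm_partialSum_le (c : Y b hJ) (N : ℕ) : ‖c.partialSum N‖ ≤ ‖c‖ :=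
  le_ciSup c.bddAbove_partialSum N

theorem eq_zero_of_partialSum {c : Y b hJ} (h : ∀ N, c.partialSum N = 0) : c = 0 := by
  classical
  ext i
  have key : initial J (i + 1) = insert i (initial J i) := by
    ext j
    simp only [initial, Finset.mem_subtype, Finset.mem_range, Finset.mem_insert, Subtype.ext_iff]
    omega
  have hi : i ∉ initial J i := by simp [initial]
  have h1 := h (i + 1)
  rw [partialSum, key, Finset.sum_insert hi] at h1
  have h2 := h i
  rw [partialSum] at h2
  rw [h2, add_zero, smul_eq_zero] at h1
  exact h1.resolve_right (b.vec_ne_zero _)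

theorem normCore : NormedSpace.Core ℝ (Y b hJ) where
  norm_nonneg c := Real.iSup_nonneg fun _ => norm_nonneg _
  norm_smul r c := by
    simp only [norm_def, partialSum_smul, norm_smul]
    exact (Real.mul_iSup_of_nonneg (norm_nonneg r) _).symm
  norm_triangle c d := ciSup_le fun N => by
    rw [partialSum_add]
    exact (norm_add_le _ _).trans (add_le_add (norm_partialSum_le c N) (norm_partialSum_le d N))
  norm_eq_zero_iff c := by
    refine ⟨fun h => eq_zero_of_partialSum fun N => ?_, ?_⟩
    · exact norm_le_zero_iff.1 ((norm_partialSum_le c N).trans h.le)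
    · rintro rfl
      simp [norm_def, partialSum]

instance : NormedAddCommGroup (Y b hJ) := NormedAddCommGroup.ofCore normCore

instance : NormedSpace ℝ (Y b hJ) := NormedSpace.ofCore normCore

end Y

end CoeffSpace

/-! ### The condition CRC+ -/

section CRC

variable {I J₁ J₂ : Set ℕ} {E F : Type*} [NormedAddCommGroup E] [NormedSpace ℝ E]
  [NormedAddCommGroup F] [NormedSpace ℝ F] {b : OrderedBasis I F} {h₁ : J₁ ⊆ I}

/-- The family of derivatives `(Df_i(x))_{i ∈ J₁}` of the coordinates of `f` at `x`. -/
def coordDeriv (f : E → Y b h₁) (x : E) : J₁ → StrongDual ℝ E :=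
  fun i => fderiv ℝ (fun y => f y i) x

/-- The Constant Rank Condition Plus for `f = (f_i)_{i ∈ J₁}` at `x₀`, with basic index set
`J₂ ⊆ J₁` and neighbourhood `V` of `x₀`. -/
structure CRCPlus (f : E → Y b h₁) (x₀ : E) (h₂ : J₂ ⊆ J₁) (V : Set E) : Prop where
  mem_nhds : V ∈ 𝓝 x₀
  /-- `(Df_i(x))_{i ∈ J₂}` is a Schauder basis of the closed span of `(Df_i(x))_{i ∈ J₁}`. -/
  basis : ∀ x ∈ V, IsSchauderBasis (subfamily (coordDeriv f x) h₂)
  /-- `Df_i(x) ↦ Df_i(x₀)`, `i ∈ J₂`, extends to an isomorphism of the closed spans. -/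
  iso : ∀ x ∈ V,
    ∃ z : closedSpan (coordDeriv f x ∘ Set.inclusion h₂) ≃L[ℝ]
        closedSpan (coordDeriv f x₀ ∘ Set.inclusion h₂),
      ∀ i : J₂, z ⟨_, mem_closedSpan (coordDeriv f x ∘ Set.inclusion h₂) i⟩ =
        ⟨_, mem_closedSpan (coordDeriv f x₀ ∘ Set.inclusion h₂) i⟩
  /-- The image `{(Df_i(x₀) e)_{i ∈ J₂} | e ∈ E}` is closed in `Y(J₂)`. -/
  isClosed_image : IsClosed {c : Y b (h₂.trans h₁) |
    ∃ e : E, ∀ i : J₂, c i = coordDeriv f x₀ (Set.inclusion h₂ i) e}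
  shrinking : IsShrinking (subfamily (coordDeriv f x₀) h₂)
  boundedlyComplete : IsBoundedlyComplete (subfamily (coordDeriv f x₀) h₂)
  besselian : IsBesselian (subfamily (coordDeriv f x₀) h₂)
  /-- `Df_i(x₀)^* ∈ E`: the biorthogonal functional is the evaluation at an element of `E`. -/
  dual_mem : ∀ i : J₂, ∃ e : E, IsCoeffFunctional (subfamily (coordDeriv f x₀) h₂) i
    ((NormedSpace.inclusionInDoubleDual ℝ E e).comp (closedSpan (coordDeriv f x₀)).subtypeL)

end CRC

end FunDep

end

noncomputable section

namespace FunDep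

/-! Since `b` is Besselian and Hilbertian, `Y(J)` is `ℓ²(J)` up to isomorphism
(`Y.exists_equiv_L2`), so `G = (f_i)`, `i ∈ J₂`, is a `C¹` map near `x₀` into a Hilbert space. It is
a submersion at `x₀`: the range of `DG(x₀)` is closed, and a vector `w` orthogonal to it gives `∑
w_i Df_i(x₀) = 0`, whence `w = 0` by uniqueness of expansions (`surjective_of_isClosed_range`). For
`x ∈ V`, expanding `Df_l(x)` in the `Df_i(x)`, `i ∈ J₂`, shows that it vanishes on `ker DG(x)`.

The kernel need not be complemented, so the fibres of `G` are not parametrised. Instead,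
`eq_of_fibre` shows that `f_l` is constant on them locally: a point of the fibre through `x` can be
moved along the fibre towards `x` with an arbitrarily small change of `f_l` relative to the distance
gained (`exists_descent`), and a Caristi–Ekeland argument carries this all the way to `x`. Hence
`h_l = f_l ∘ σ` does not depend on the section `σ` of `G`; Graves' theorem supplies preimages at
linear cost, which makes `h_l` strictly differentiable (`exists_contDiffOn_comp_eq`). All radii
depend on `G` only, so one neighbourhood serves every `l`. A bump function makes `h_l` global. -/

/-! ### An ordering principle in complete metric spaces -/

/-- A variant of the Caristi–Ekeland principle: a transitive relation with closed sections along
which the distance is controlled by the decrease of a function bounded below has minimal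
elements. -/
theorem exists_minimal_of_dist_le_sub {X : Type*} [MetricSpace X] [CompleteSpace X]
    (r : X → X → Prop) (hrefl : ∀ p, r p p) (htrans : ∀ p q s, r p q → r q s → r p s)
    (hclosed : ∀ p, IsClosed {q | r p q}) (Φ : X → ℝ) (hΦ : ∀ p, 0 ≤ Φ p)
    (hdist : ∀ p q, r p q → dist p q ≤ Φ p - Φ q) (p₀ : X) :
    ∃ q, r p₀ q ∧ ∀ q', r q q' → q' = q := by
  -- Take `q` with `Φ q` within `ε` of the infimum over the section of `p`; by transitivity every
  -- successor of `q` lies in that section too.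
  have step : ∀ (p : X) (ε : ℝ), 0 < ε → ∃ q, r p q ∧ ∀ q', r q q' → dist q q' ≤ ε := by
    intro p ε hε
    have hbdd : BddBelow (Φ '' {q | r p q}) := ⟨0, by rintro _ ⟨q, -, rfl⟩; exact hΦ q⟩
    obtain ⟨_, ⟨q, hq, rfl⟩, hlt⟩ := exists_lt_of_csInf_lt
      (s := Φ '' {q | r p q}) ⟨_, p, hrefl p, rfl⟩
      (lt_add_of_pos_right (sInf (Φ '' {q | r p q})) hε)
    refine ⟨q, hq, fun q' hq' => (hdist q q' hq').trans ?_⟩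
    have := csInf_le hbdd ⟨q', htrans p q q' hq hq', rfl⟩
    linarith
  choose! next hnext hsmall using step
  let u : ℕ → X := fun n => Nat.rec p₀ (fun k p => next p ((1 / 2 : ℝ) ^ k)) n
  have hpos : ∀ k : ℕ, (0 : ℝ) < (1 / 2 : ℝ) ^ k := fun k => by positivity
  have hu1 : ∀ n, r (u n) (u (n + 1)) := fun n => hnext _ _ (hpos n)
  have hu2 : ∀ n q, r (u (n + 1)) q → dist (u (n + 1)) q ≤ (1 / 2 : ℝ) ^ n :=
    fun n q => hsmall _ _ (hpos n) q
  have hmono : ∀ n k, r (u n) (u (n + k)) := by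
    intro n k
    induction k with
    | zero => exact hrefl _
    | succ k ih => exact htrans _ _ _ ih (hu1 _)
  have hlim : Tendsto (fun n : ℕ => (1 / 2 : ℝ) ^ n) atTop (𝓝 0) :=
    tendsto_pow_atTop_nhds_zero_of_lt_one (by norm_num) (by norm_num)
  have hcauchy : CauchySeq fun n => u (n + 1) := by
    refine cauchySeq_of_le_tendsto_0' (fun n : ℕ => (1 / 2 : ℝ) ^ n) (fun n m hnm => ?_) hlim
    obtain ⟨k, rfl⟩ := Nat.exists_eq_add_of_le hnm
    refine hu2 n _ ?_
    have := hmono (n + 1) k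
    rwa [show n + 1 + k = n + k + 1 by omega] at this
  obtain ⟨q, hq⟩ := cauchySeq_tendsto_of_complete hcauchy
  have hq' : Tendsto u atTop (𝓝 q) := (tendsto_add_atTop_iff_nat 1).1 hq
  have hmem : ∀ n, r (u n) q := fun n => by
    refine (hclosed (u n)).mem_of_tendsto hq' (eventually_atTop.2 ⟨n, fun m hm => ?_⟩)
    obtain ⟨k, rfl⟩ := Nat.exists_eq_add_of_le hm
    exact hmono n k
  refine ⟨q, hmem 0, fun q' hqq' => ?_⟩
  refine tendsto_nhds_unique (f := fun n => u (n + 1)) ?_ hq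
  rw [tendsto_iff_dist_tendsto_zero]
  exact squeeze_zero (fun _ => dist_nonneg)
    (fun n => hu2 n _ (htrans _ _ _ (hmem (n + 1)) hqq')) hlim

/-! ### Functions on the fibres of a submersion -/

/-- If `ψ` has strict derivative zero at `p` then it is `ε`-Lipschitz near `p`. -/
theorem eventually_abs_sub_le_of_hasStrictFDerivAt_zero {E : Type*} [NormedAddCommGroup E]
    [NormedSpace ℝ E] {ψ : E → ℝ} {p : E}
    (h : HasStrictFDerivAt ψ (0 : E →L[ℝ] ℝ) p) {ε : ℝ} (hε : 0 < ε) :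
    ∀ᶠ z : E × E in 𝓝 (p, p), |ψ z.1 - ψ z.2| ≤ ε * ‖z.1 - z.2‖ := by
  simpa using h.isLittleO.def hε

section Submersion

variable {E H : Type*} [NormedAddCommGroup E] [NormedSpace ℝ E] [CompleteSpace E]
  [NormedAddCommGroup H] [NormedSpace ℝ H]

/-- Graves' theorem: near-solutions of `G q = y` can be corrected to solutions. -/
theorem exists_eq_of_approximatesLinearOn {G : E → H} {T : E →L[ℝ] H} {s : Set E} {c : NNReal}
    (hG : ApproximatesLinearOn G T s c) (S : T.NonlinearRightInverse) (hS : 0 < S.nnnorm)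
    (hc : 16 * (c * S.nnnorm : ℝ) ≤ 1) {p : E} {y : H} {δ : ℝ} (hδ : 2 * S.nnnorm * ‖y - G p‖ ≤ δ)
    (hs : Metric.closedBall p δ ⊆ s) :
    ∃ q, G q = y ∧ ‖q - p‖ ≤ δ := by
  have hC : (0 : ℝ) < S.nnnorm := hS
  have hδ0 : 0 ≤ δ := le_trans (by positivity) hδ
  obtain ⟨q, hq, rfl⟩ := hG.surjOn_closedBall_of_nonlinearRightInverse S hδ0 hs
    (show y ∈ Metric.closedBall (G p) (((S.nnnorm : ℝ)⁻¹ - c) * δ) by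
      rw [mem_closedBall_iff_norm]
      have h1 : ‖y - G p‖ ≤ δ / (2 * S.nnnorm) := by
        rw [le_div_iff₀ (by positivity)]; linarith
      refine h1.trans ?_
      have h2 : (c : ℝ) ≤ 1 / (16 * S.nnnorm) := by
        rw [le_div_iff₀ (by positivity)]; linarith
      have h3 : 1 / (2 * (S.nnnorm : ℝ)) ≤ (S.nnnorm : ℝ)⁻¹ - c := by
        have e1 : 1 / (2 * (S.nnnorm : ℝ)) = 1 / 2 * (S.nnnorm : ℝ)⁻¹ := by field_simp
        have e2 : 1 / (16 * (S.nnnorm : ℝ)) = 1 / 16 * (S.nnnorm : ℝ)⁻¹ := by field_simp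
        have : 0 < (S.nnnorm : ℝ)⁻¹ := by positivity
        rw [e1]; rw [e2] at h2; linarith
      calc δ / (2 * S.nnnorm) = 1 / (2 * (S.nnnorm : ℝ)) * δ := by ring
        _ ≤ _ := by gcongr)
  exact ⟨q, rfl, mem_closedBall_iff_norm.1 hq⟩

/-- From any point `p` of the fibre through `x` one can move along the fibre closer to `x`, at a
cost controlled by the gain in distance. -/
theorem exists_descent {G : E → H} {T : E →L[ℝ] H} {s : Set E} {c : NNReal}
    (hG : ApproximatesLinearOn G T s c) (S : T.NonlinearRightInverse) (hS : 0 < S.nnnorm)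
    (hc : 16 * (c * S.nnnorm : ℝ) ≤ 1) {φ : E → ℝ} {p x : E}
    (hφ : ∃ μ : StrongDual ℝ H, HasStrictFDerivAt (fun x => φ x - μ (G x)) (0 : E →L[ℝ] ℝ) p)
    (hs : Metric.closedBall x ‖p - x‖ ⊆ s) (hpx : G p = G x) (hne : p ≠ x) {ε : ℝ} (hε : 0 < ε) :
    ∃ q, G q = G x ∧ ‖q - x‖ < ‖p - x‖ ∧ ‖p - q‖ ≤ 2 * (‖p - x‖ - ‖q - x‖) ∧
      |φ p - φ q| ≤ 2 * ε * (‖p - x‖ - ‖q - x‖) := by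
  obtain ⟨μ, hμ⟩ := hφ
  set d := ‖p - x‖ with hd
  have hd0 : 0 < d := norm_pos_iff.2 (sub_ne_zero.2 hne)
  have hev := eventually_abs_sub_le_of_hasStrictFDerivAt_zero hμ hε
  obtain ⟨η, hη, hball⟩ := Metric.eventually_nhds_iff.1 hev
  obtain ⟨h, hh0, hh1, hhη⟩ : ∃ h : ℝ, 0 < h ∧ h < 1 ∧ 5 / 4 * h * d < η := by
    refine ⟨min (1 / 2) (η / (2 * d)), by positivity, by
      exact (min_le_left _ _).trans_lt (by norm_num), ?_⟩
    have : min (1 / 2) (η / (2 * d)) * d ≤ η / 2 := by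
      calc min (1 / 2) (η / (2 * d)) * d ≤ η / (2 * d) * d := by gcongr; exact min_le_right _ _
        _ = η / 2 := by field_simp
    linarith
  have hcS : (c : ℝ) * S.nnnorm ≤ 1 / 16 := by linarith
  have hps : p ∈ s := hs (mem_closedBall_iff_norm.2 le_rfl)
  have hxs : x ∈ s := hs (by simp [hd])
  -- The step along the segment gains `h * d`. As `G p = G x`, `T (x - p)` is at most `c * d`, so
  -- `z` misses the fibre by at most `2 * c * h * d`; by the factor 16 in `hc` the correction costs
  -- at most `h * d / 4`.
  set z := p + h • (x - p) with hz
  have hxz : ‖z - x‖ = (1 - h) * d := by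
    rw [show z - x = (1 - h) • (p - x) by rw [hz]; module, norm_smul, Real.norm_of_nonneg
      (by linarith)]
  have hpz : ‖z - p‖ = h * d := by
    rw [show z - p = h • (x - p) by rw [hz]; module, norm_smul, Real.norm_of_nonneg hh0.le,
      norm_sub_rev, hd]
  have hzs : z ∈ s := hs (by
    rw [mem_closedBall_iff_norm, hxz]; nlinarith)
  have hT : ‖T (x - p)‖ ≤ c * d := by
    have := hG x hxs p hps
    rwa [← hpx, sub_self, zero_sub, norm_neg, norm_sub_rev x p] at this
  have hGz : ‖G x - G z‖ ≤ 2 * c * (h * d) := by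
    have h1 := hG z hzs p hps
    rw [hpz] at h1
    have h2 : ‖T (z - p)‖ ≤ h * (c * d) := by
      rw [show z - p = h • (x - p) by rw [hz]; module, map_smul, norm_smul,
        Real.norm_of_nonneg hh0.le]
      gcongr
    rw [← hpx, norm_sub_rev]
    calc ‖G z - G p‖ = ‖(G z - G p - T (z - p)) + T (z - p)‖ := by rw [sub_add_cancel]
      _ ≤ _ := norm_add_le _ _
      _ ≤ c * (h * d) + h * (c * d) := add_le_add h1 h2
      _ = _ := by ring
  have hδ : 2 * S.nnnorm * ‖G x - G z‖ ≤ h * d / 4 := by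
    have hhd : 0 < h * d := by positivity
    calc 2 * S.nnnorm * ‖G x - G z‖ ≤ 2 * S.nnnorm * (2 * c * (h * d)) := by gcongr
      _ = 4 * (c * S.nnnorm) * (h * d) := by ring
      _ ≤ 4 * (1 / 16) * (h * d) := by gcongr
      _ = _ := by ring
  obtain ⟨q, hq, hqz⟩ := exists_eq_of_approximatesLinearOn hG S hS hc hδ (by
    refine subset_trans ?_ hs
    intro w hw
    rw [mem_closedBall_iff_norm] at hw ⊢
    calc ‖w - x‖ = ‖(w - z) + (z - x)‖ := by rw [sub_add_sub_cancel]
      _ ≤ _ := norm_add_le _ _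
      _ ≤ h * d / 4 + (1 - h) * d := by rw [hxz]; gcongr
      _ ≤ d := by nlinarith)
  have hhd : 0 < h * d := by positivity
  have hqx : ‖q - x‖ ≤ d - 3 / 4 * (h * d) := by
    calc ‖q - x‖ = ‖(q - z) + (z - x)‖ := by rw [sub_add_sub_cancel]
      _ ≤ _ := norm_add_le _ _
      _ ≤ h * d / 4 + (1 - h) * d := by rw [hxz]; gcongr
      _ = _ := by ring
  have hqp : ‖p - q‖ ≤ 5 / 4 * (h * d) := by
    rw [norm_sub_rev]
    calc ‖q - p‖ = ‖(q - z) + (z - p)‖ := by rw [sub_add_sub_cancel]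
      _ ≤ _ := norm_add_le _ _
      _ ≤ h * d / 4 + h * d := by rw [hpz]; gcongr
      _ = _ := by ring
  -- The gain is at least `3/4 * h * d` and the displacement at most `5/4 * h * d`, so the factor 2
  -- suffices. On the fibre the `μ ∘ G` terms cancel.
  refine ⟨q, hq, by linarith, by linarith, ?_⟩
  have key := @hball (p, q) (by
    rw [Prod.dist_eq, max_lt_iff]
    refine ⟨by simpa using hη, ?_⟩
    rw [dist_comm, dist_eq_norm]
    linarith)
  simp only [hq, hpx, sub_sub_sub_cancel_right] at key
  nlinarith

/-- A function whose differential is everywhere a multiple of that of the submersion `G` is locally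
constant along the fibres of `G`. -/
theorem eq_of_fibre {G : E → H} {T : E →L[ℝ] H} {s : Set E} {c : NNReal}
    (hG : ApproximatesLinearOn G T s c) (S : T.NonlinearRightInverse) (hS : 0 < S.nnnorm)
    (hc : 16 * (c * S.nnnorm : ℝ) ≤ 1) {φ : E → ℝ} (hφc : ContinuousOn φ s)
    (hφ : ∀ p ∈ s, ∃ μ : StrongDual ℝ H,
      HasStrictFDerivAt (fun x => φ x - μ (G x)) (0 : E →L[ℝ] ℝ) p)
    {p x : E} (hs : Metric.closedBall x ‖p - x‖ ⊆ s) (hpx : G p = G x) : φ p = φ x := by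
  set D := ‖p - x‖
  let K : Set E := Metric.closedBall x D ∩ G ⁻¹' {G x}
  have hK : IsClosed K :=
    (hG.continuousOn.mono hs).preimage_isClosed_of_isClosed Metric.isClosed_closedBall
      isClosed_singleton
  have : CompleteSpace K := hK.completeSpace_coe
  have hφK : Continuous fun q : K => φ q :=
    continuousOn_iff_continuous_domRestrict.1 (hφc.mono (Set.inter_subset_left.trans hs))
  refine eq_of_abs_sub_le_all (x := φ p) (y := φ x) fun ε' hε' => ?_
  obtain ⟨ε, hε, hεD⟩ : ∃ ε : ℝ, 0 < ε ∧ 2 * ε * D ≤ ε' := by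
    have hD : 0 ≤ D := norm_nonneg _
    refine ⟨ε' / (2 * (D + 1)), by positivity, ?_⟩
    rw [show 2 * (ε' / (2 * (D + 1))) * D = ε' * (D / (D + 1)) by field_simp]
    exact mul_le_of_le_one_right hε'.le (div_le_one_of_le₀ (by linarith) (by linarith))
  -- Both displacement and change of `φ` are charged to the decrease of the distance to `x`. A
  -- minimal point other than `x` would contradict `exists_descent`.
  obtain ⟨q, hq, hmin⟩ := exists_minimal_of_dist_le_sub
    (fun p q : K => ‖(p : E) - q‖ ≤ 2 * (‖(p : E) - x‖ - ‖(q : E) - x‖) ∧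
      |φ p - φ q| ≤ 2 * ε * (‖(p : E) - x‖ - ‖(q : E) - x‖))
    (fun p => by simp)
    (fun a b d h1 h2 => by
      refine ⟨?_, ?_⟩
      · have := norm_sub_le_norm_sub_add_norm_sub (a : E) b d
        linarith [h1.1, h2.1]
      · have := abs_sub_le (φ a) (φ b) (φ d)
        linarith [h1.2, h2.2])
    (fun a => by
      have h1 : IsClosed {q : K | ‖(a : E) - q‖ ≤ 2 * (‖(a : E) - x‖ - ‖(q : E) - x‖)} :=
        isClosed_le (by fun_prop) (by fun_prop)
      have h2 : IsClosed {q : K | |φ a - φ q| ≤ 2 * ε * (‖(a : E) - x‖ - ‖(q : E) - x‖)} :=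
        isClosed_le (continuous_const.sub hφK).abs (by fun_prop)
      exact h1.inter h2)
    (fun a => 2 * ‖(a : E) - x‖) (fun a => by positivity)
    (fun a b h => by rw [Subtype.dist_eq, dist_eq_norm]; linarith [h.1])
    ⟨p, mem_closedBall_iff_norm.2 le_rfl, hpx⟩
  have hqx : (q : E) = x := by
    by_contra hne
    have hqD : ‖(q : E) - x‖ ≤ D := mem_closedBall_iff_norm.1 q.2.1
    obtain ⟨q', h1, h2, h3, h4⟩ := exists_descent hG S hS hc (hφ q (hs q.2.1))
      ((Metric.closedBall_subset_closedBall hqD).trans hs) q.2.2 hne hε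
    have := hmin ⟨q', by rw [mem_closedBall_iff_norm]; linarith, h1⟩ ⟨h3, h4⟩
    rw [← this] at h2
    exact lt_irrefl _ h2
  have := hq.2
  simp only [hqx, sub_self, norm_zero, sub_zero] at this
  exact this.trans hεD

end Submersion

/-! ### Functional dependence for a submersion -/

/-- A function with strict derivatives on an open set is of class `C¹` there. -/
theorem contDiffOn_one_of_hasStrictFDerivAt {E F : Type*} [NormedAddCommGroup E] [NormedSpace ℝ E]
    [NormedAddCommGroup F] [NormedSpace ℝ F] {h : E → F} {s : Set E} (hs : IsOpen s)
    (hh : ∀ y ∈ s, ∃ A : E →L[ℝ] F, HasStrictFDerivAt h A y) : ContDiffOn ℝ 1 h s := by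
  have hd : ∀ y ∈ s, HasStrictFDerivAt h (fderiv ℝ h y) y := fun y hy => by
    obtain ⟨A, hA⟩ := hh y hy
    rwa [hA.hasFDerivAt.fderiv]
  rw [← zero_add (1 : WithTop ℕ∞), contDiffOn_succ_iff_fderiv_of_isOpen hs, contDiffOn_zero]
  refine ⟨fun y hy => (hd y hy).hasFDerivAt.differentiableAt.differentiableWithinAt, by simp,
    fun y hy => ContinuousAt.continuousWithinAt ?_⟩
  rw [Metric.continuousAt_iff']
  intro ε hε
  -- Strictness makes `h - Dh(y)` Lipschitz with constant `ε / 2` near `y`, which bounds `Dh(z) -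
  -- Dh(y)`.
  obtain ⟨t, ht, happ⟩ := (hd y hy).approximates_deriv_on_nhds (c := ⟨ε / 2, by positivity⟩)
    (Or.inr (by exact half_pos hε))
  filter_upwards [eventually_mem_nhds_iff.2 ht, hs.mem_nhds hy] with z hz hzs
  have h1 : HasFDerivAt (h - (fderiv ℝ h y : E → F)) (fderiv ℝ h z - fderiv ℝ h y) z :=
    (hd z hzs).hasFDerivAt.sub (fderiv ℝ h y).hasFDerivAt
  have h2 := h1.le_of_lipschitzOn hz happ.lipschitzOnWith
  rw [dist_eq_norm]
  exact lt_of_le_of_lt h2 (half_lt_self hε)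

section Factor

variable {E H : Type*} [NormedAddCommGroup E] [NormedSpace ℝ E] [CompleteSpace E]
  [NormedAddCommGroup H] [NormedSpace ℝ H]

/-- A linear map close to a surjection is surjective. -/
theorem surjective_of_norm_sub_le {T A : E →L[ℝ] H} (S : T.NonlinearRightInverse)
    (hS : 0 < S.nnnorm) {c : NNReal} (hc : 16 * (c * S.nnnorm : ℝ) ≤ 1) (hA : ‖A - T‖ ≤ c) :
    Function.Surjective A := by
  intro y
  have hAT : ApproximatesLinearOn A T Set.univ c := by
    intro u _ v _
    rw [← map_sub, ← sub_apply]
    exact (A - T).le_of_opNorm_le hA _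
  obtain ⟨q, hq, -⟩ := exists_eq_of_approximatesLinearOn hAT S hS hc (p := 0) (y := y) le_rfl
    (Set.subset_univ _)
  exact ⟨q, hq⟩

variable [CompleteSpace H]

/-- A functional vanishing on the kernel of a surjection factors through it. -/
theorem exists_factor_of_ker_le {A : E →L[ℝ] H} (hA : Function.Surjective A) {φ : StrongDual ℝ E}
    (h : ∀ e, A e = 0 → φ e = 0) : ∃ μ : StrongDual ℝ H, ∀ e, μ (A e) = φ e := by
  obtain ⟨S, -⟩ := A.exists_nonlinearRightInverse_of_surjective (LinearMap.range_eq_top.2 hA)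
  have hS : ∀ e, φ (S (A e)) = φ e := fun e => by
    rw [← sub_eq_zero, ← map_sub]
    exact h _ (by simp)
  -- `S` need not be linear, but `φ ∘ S` is, by `hS` and surjectivity of `A`.
  have hadd : ∀ y y', φ (S (y + y')) = φ (S y) + φ (S y') := fun y y' => by
    obtain ⟨e, rfl⟩ := hA y
    obtain ⟨e', rfl⟩ := hA y'
    rw [← map_add, hS, hS, hS, map_add]
  have hsmul : ∀ (r : ℝ) y, φ (S (r • y)) = r * φ (S y) := fun r y => by
    obtain ⟨e, rfl⟩ := hA y
    rw [← map_smul, hS, hS, map_smul, smul_eq_mul]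
  refine ⟨LinearMap.mkContinuous ⟨⟨fun y => φ (S y), hadd⟩, hsmul⟩ (‖φ‖ * S.nnnorm) fun y => ?_, hS⟩
  calc ‖φ (S y)‖ ≤ ‖φ‖ * ‖S y‖ := φ.le_opNorm _
    _ ≤ ‖φ‖ * (S.nnnorm * ‖y‖) := by gcongr; exact S.bound y
    _ = _ := by ring

/-- **Functional dependence.** Let `G` be a submersion at `x₀` (whose kernel need not be
complemented), and let `φ l` be functions with `ker DG(x) ≤ ker Dφ l (x)` for all `x` near `x₀`.
Then the `φ l` are, on a neighbourhood of `x₀` independent of `l`, functions of class `C¹`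
of `G`. -/
theorem exists_contDiffOn_comp_eq {ι : Type*} {G : E → H} {φ : ι → E → ℝ} {s : Set E} {x₀ : E}
    (hs : s ∈ 𝓝 x₀) (hG : ∀ x ∈ s, ContDiffAt ℝ 1 G x)
    (hφ : ∀ l, ∀ x ∈ s, ContDiffAt ℝ 1 (φ l) x)
    (hsurj : Function.Surjective (fderiv ℝ G x₀))
    (hker : ∀ l, ∀ x ∈ s, ∀ e, fderiv ℝ G x e = 0 → fderiv ℝ (φ l) x e = 0) :
    ∃ ρ > 0, ∃ h : ι → H → ℝ, (∀ l, ContDiffOn ℝ 1 (h l) (Metric.ball (G x₀) ρ)) ∧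
      ∀ᶠ x in 𝓝 x₀, ∀ l, φ l x = h l (G x) := by
  set T := fderiv ℝ G x₀ with hT
  obtain ⟨S, hS⟩ := T.exists_nonlinearRightInverse_of_surjective (LinearMap.range_eq_top.2 hsurj)
  have hC : (0 : ℝ) < S.nnnorm := hS
  obtain ⟨c, hc0, hc⟩ : ∃ c : NNReal, 0 < c ∧ 16 * (c * S.nnnorm : ℝ) ≤ 1 := by
    refine ⟨(16 * S.nnnorm)⁻¹, by positivity, ?_⟩
    push_cast
    field_simp
    rfl
  obtain ⟨t, ht, happ⟩ := ((hG x₀ (mem_of_mem_nhds hs)).hasStrictFDerivAt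
    one_ne_zero).approximates_deriv_on_nhds (c := c) (Or.inr hc0)
  obtain ⟨R, hR, hRst⟩ := Metric.mem_nhds_iff.1 (inter_mem hs ht)
  set B := Metric.ball x₀ R with hB
  have hBs : B ⊆ s := hRst.trans Set.inter_subset_left
  have happB : ApproximatesLinearOn G T B c := happ.mono_set (hRst.trans Set.inter_subset_right)
  have hGd : ∀ x ∈ B, HasStrictFDerivAt G (fderiv ℝ G x) x := fun x hx =>
    (hG x (hBs hx)).hasStrictFDerivAt one_ne_zero
  have hφd : ∀ l, ∀ x ∈ B, HasStrictFDerivAt (φ l) (fderiv ℝ (φ l) x) x := fun l x hx =>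
    (hφ l x (hBs hx)).hasStrictFDerivAt one_ne_zero
  have hsurjB : ∀ x ∈ B, Function.Surjective (fderiv ℝ G x) := fun x hx => by
    refine surjective_of_norm_sub_le S hS hc ?_
    have h1 : HasFDerivAt (G - (T : E → H)) (fderiv ℝ G x - T) x := (hGd x hx).hasFDerivAt.sub T.hasFDerivAt
    exact h1.le_of_lipschitzOn (Metric.isOpen_ball.mem_nhds hx) happB.lipschitzOnWith
  have hfac : ∀ l, ∀ x ∈ B, ∃ μ : StrongDual ℝ H,
      HasStrictFDerivAt (fun z => φ l z - μ (G z)) (0 : E →L[ℝ] ℝ) x := fun l x hx => by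
    obtain ⟨μ, hμ⟩ := exists_factor_of_ker_le (hsurjB x hx) (hker l x (hBs hx))
    refine ⟨μ, ?_⟩
    have h1 := (hφd l x hx).sub (μ.hasStrictFDerivAt.comp x (hGd x hx))
    rwa [show fderiv ℝ (φ l) x - μ ∘SL fderiv ℝ G x = 0 by ext e; simp [hμ]] at h1
  have hφc : ∀ l, ContinuousOn (φ l) B := fun l x hx =>
    (hφd l x hx).continuousAt.continuousWithinAt
  have hfib : ∀ l p x, p ∈ Metric.ball x₀ (R / 3) → x ∈ Metric.ball x₀ (R / 3) → G p = G x →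
      φ l p = φ l x := by
    intro l p x hp hx hpx
    refine eq_of_fibre happB S hS hc (hφc l) (hfac l) ?_ hpx
    rw [Metric.mem_ball] at hp hx
    refine Metric.closedBall_subset_ball' ?_
    rw [← dist_eq_norm]
    linarith [dist_triangle_right p x x₀]
  have hsol : ∀ p y, p ∈ Metric.ball x₀ (R / 3) → 2 * S.nnnorm * ‖y - G p‖ ≤ R / 6 →
      ∃ q, G q = y ∧ ‖q - p‖ ≤ 2 * S.nnnorm * ‖y - G p‖ := by
    intro p y hp hy
    refine exists_eq_of_approximatesLinearOn happB S hS hc le_rfl (Metric.closedBall_subset_ball' ?_)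
    rw [Metric.mem_ball] at hp
    linarith
  set ρ := R / (12 * S.nnnorm) with hρ
  have hρ0 : 0 < ρ := by positivity
  have hρS : 2 * S.nnnorm * ρ = R / 6 := by rw [hρ]; field_simp; norm_num
  have hx₀ : x₀ ∈ Metric.ball x₀ (R / 3) := Metric.mem_ball_self (by positivity)
  have hsec : ∀ y ∈ Metric.ball (G x₀) ρ, ∃ q, G q = y ∧ q ∈ Metric.ball x₀ (R / 5) := by
    intro y hy
    have hy' : 2 * S.nnnorm * ‖y - G x₀‖ ≤ R / 6 := by
      rw [← hρS]; gcongr; exact (mem_ball_iff_norm.1 hy).le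
    obtain ⟨q, hq, hqx⟩ := hsol x₀ y hx₀ hy'
    exact ⟨q, hq, mem_ball_iff_norm.2 (by linarith)⟩
  -- No continuity of `σ` is needed: by `hfib` it may be replaced by any nearby preimage.
  choose! σ hσ hσR using hsec
  have hsub : Metric.ball x₀ (R / 5) ⊆ Metric.ball x₀ (R / 3) :=
    Metric.ball_subset_ball (by linarith)
  refine ⟨ρ, hρ0, fun l y => φ l (σ y), fun l => ?_, ?_⟩
  · refine contDiffOn_one_of_hasStrictFDerivAt Metric.isOpen_ball fun y hy => ?_
    have hp := hσR y hy
    have hpB : σ y ∈ B := Metric.ball_subset_ball (by linarith) hp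
    obtain ⟨μ, hμ⟩ := hfac l (σ y) hpB
    refine ⟨μ, .of_isLittleO ?_⟩
    rw [Asymptotics.isLittleO_iff]
    intro ε hε
    have hev := eventually_abs_sub_le_of_hasStrictFDerivAt_zero hμ
      (ε := ε / (2 * S.nnnorm)) (by positivity)
    obtain ⟨η, hη, hball⟩ := Metric.eventually_nhds_iff.1 hev
    -- The cap `R / 12` keeps the corrected points `q`, `q'` inside the ball of radius `R / 3` where
    -- `hfib` and `hsol` apply.
    set η' := min η (R / 12) with hη'
    have hη'0 : 0 < η' := by positivity
    set δ := η' / (8 * S.nnnorm) with hδ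
    have hδ0 : 0 < δ := by positivity
    have hδS : 2 * S.nnnorm * δ = η' / 4 := by rw [hδ]; field_simp; norm_num
    have hη1 : η' ≤ η := min_le_left _ _
    have hη2 : η' ≤ R / 12 := min_le_right _ _
    have hnhds : Metric.ball y δ ∩ Metric.ball (G x₀) ρ ∈ 𝓝 y :=
      inter_mem (Metric.ball_mem_nhds y hδ0) (Metric.isOpen_ball.mem_nhds hy)
    filter_upwards [prod_mem_nhds hnhds hnhds] with z hz
    obtain ⟨⟨h1, h1'⟩, ⟨h2, h2'⟩⟩ := hz
    rw [mem_ball_iff_norm] at h1 h2 hp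
    have a2 : 2 * S.nnnorm * ‖z.2 - G (σ y)‖ ≤ η' / 4 := by
      rw [hσ y hy, ← hδS]; gcongr
    obtain ⟨q, hq, hqp⟩ := hsol (σ y) z.2 (hsub (hσR y hy)) (by linarith)
    have hqR : ‖q - x₀‖ < R / 3 := by
      linarith [norm_sub_le_norm_sub_add_norm_sub q (σ y) x₀]
    have a1 : 2 * S.nnnorm * ‖z.1 - G q‖ ≤ η' / 2 := by
      have : ‖z.1 - z.2‖ ≤ 2 * δ := by
        have := norm_sub_le_norm_sub_add_norm_sub z.1 y z.2
        rw [norm_sub_rev y z.2] at this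
        linarith
      rw [hq]
      calc 2 * S.nnnorm * ‖z.1 - z.2‖ ≤ 2 * S.nnnorm * (2 * δ) := by gcongr
        _ = 2 * (2 * S.nnnorm * δ) := by ring
        _ = η' / 2 := by rw [hδS]; ring
    -- Starting from `q` rather than `σ y` bounds `q' - q` linearly by `z.1 - z.2`, as a strict
    -- derivative requires.
    obtain ⟨q', hq', hqq'⟩ := hsol q z.1 (mem_ball_iff_norm.2 hqR) (by linarith)
    have hqp' : ‖q' - σ y‖ < η' := by
      linarith [norm_sub_le_norm_sub_add_norm_sub q' q (σ y)]
    have hqR' : ‖q' - x₀‖ < R / 3 := by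
      linarith [norm_sub_le_norm_sub_add_norm_sub q' (σ y) x₀]
    have e2 : φ l (σ z.2) = φ l q :=
      hfib l _ _ (hsub (hσR _ h2')) (mem_ball_iff_norm.2 hqR) ((hσ _ h2').trans hq.symm)
    have e1 : φ l (σ z.1) = φ l q' :=
      hfib l _ _ (hsub (hσR _ h1')) (mem_ball_iff_norm.2 hqR') ((hσ _ h1').trans hq'.symm)
    have key := @hball (q', q) (by
      rw [Prod.dist_eq, max_lt_iff, dist_eq_norm, dist_eq_norm]
      exact ⟨by simpa using hqp'.trans_le hη1, by
        change ‖q - σ y‖ < η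
        linarith⟩)
    simp only [hq, hq'] at key
    rw [e1, e2, map_sub, Real.norm_eq_abs]
    calc |φ l q' - φ l q - (μ z.1 - μ z.2)| = |φ l q' - μ z.1 - (φ l q - μ z.2)| := by
          congr 1; ring
      _ ≤ _ := key
      _ ≤ ε / (2 * S.nnnorm) * (2 * S.nnnorm * ‖z.1 - z.2‖) := by rw [← hq]; gcongr
      _ = ε * ‖z.1 - z.2‖ := by field_simp
  · have hcont : ContinuousAt G x₀ := (hGd x₀ (Metric.mem_ball_self hR)).continuousAt
    filter_upwards [hcont (Metric.ball_mem_nhds (G x₀) hρ0),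
      Metric.ball_mem_nhds x₀ (show 0 < R / 3 by positivity)] with x hx1 hx2 l
    exact hfib l _ _ hx2 (hsub (hσR _ hx1)) (hσ _ hx1).symm

end Factor

/-- In a Hilbert space, a function of class `C¹` on a ball agrees near its centre with one of class
`C¹` everywhere. -/
theorem exists_contDiff_eq_on_ball {H : Type*} [NormedAddCommGroup H] [InnerProductSpace ℝ H]
    {h : H → ℝ} {y : H} {ρ : ℝ} (hρ : 0 < ρ) (hh : ContDiffOn ℝ 1 h (Metric.ball y ρ)) :
    ∃ k : H → ℝ, ContDiff ℝ 1 k ∧ ∀ z ∈ Metric.ball y (ρ / 3), k z = h z := by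
  let β : ContDiffBump y := ⟨ρ / 3, ρ / 2, by positivity, by linarith⟩
  refine ⟨fun z => β z * h z, ?_, fun z hz => ?_⟩
  · rw [contDiff_iff_contDiffAt]
    intro z
    by_cases hz : z ∈ Metric.ball y ρ
    · exact β.contDiffAt.mul (hh.contDiffAt (Metric.isOpen_ball.mem_nhds hz))
    · have hz' : z ∉ tsupport β := by
        rw [β.tsupport_eq]
        intro h'
        exact hz (Metric.closedBall_subset_ball (show ρ / 2 < ρ by linarith) h')
      refine (contDiffAt_const (c := (0 : ℝ))).congr_of_eventuallyEq ?_
      filter_upwards [notMem_tsupport_iff_eventuallyEq.1 hz'] with w hw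
      simp [hw]
  · simp only
    rw [β.one_of_mem_closedBall (Metric.ball_subset_closedBall hz), one_mul]

/-! ### `Y(J)` is isomorphic to `ℓ²(J)` -/

theorem tendsto_initial_atTop (J : Set ℕ) : Tendsto (initial J) atTop atTop := by
  refine tendsto_atTop_finset_of_monotone (fun m n hmn i => ?_) fun i => ⟨i + 1, by simp [initial]⟩
  simp only [initial, Finset.mem_subtype, Finset.mem_range]
  omega

theorem hasSum_natOrder_of_hasSum {J : Set ℕ} {X : Type*} [AddCommMonoid X] [TopologicalSpace X]
    {f : J → X} {x : X} (h : HasSum f x) : HasSum f x (natOrder J) :=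
  hasSum_natOrder_iff.2 (Tendsto.comp (f := initial J) (g := fun s => ∑ i ∈ s, f i)
    (by simpa [HasSum] using h) (tendsto_initial_atTop J))

/-- Extension of a family by zero. -/
abbrev extendZero {I J : Set ℕ} (hJ : J ⊆ I) (c : J → ℝ) : I → ℝ :=
  Function.extend (Set.inclusion hJ) c 0

section Extend

variable {I J : Set ℕ} (hJ : J ⊆ I) (c : J → ℝ)

theorem extendZero_inclusion (i : J) : extendZero hJ c (Set.inclusion hJ i) = c i :=
  (Set.inclusion_injective hJ).extend_apply _ _ _

theorem extendZero_of_notMem {i : I} (hi : i ∉ Set.range (Set.inclusion hJ)) :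
    extendZero hJ c i = 0 :=
  Function.extend_apply' _ _ _ hi

/-- Both orders come from `ℕ`, so cutting at the same `N` differs only by zero terms. This transfers
hypotheses on a basis over `I` to subsets `J`. -/
theorem sum_initial_extendZero {X : Type*} [AddCommGroup X] [Module ℝ X] (w : I → X) (N : ℕ) :
    ∑ i ∈ initial I N, extendZero hJ c i • w i =
      ∑ i ∈ initial J N, c i • w (Set.inclusion hJ i) := by
  classical
  have h : ∑ i ∈ (initial J N).map ⟨_, Set.inclusion_injective hJ⟩, extendZero hJ c i • w i =
      ∑ i ∈ initial I N, extendZero hJ c i • w i := by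
    refine Finset.sum_subset (fun i => ?_) fun i hi hi' => ?_
    · simp only [Finset.mem_map, Function.Embedding.coeFn_mk]
      rintro ⟨j, hj, rfl⟩
      simpa [initial] using hj
    · rw [extendZero_of_notMem, zero_smul]
      rintro ⟨j, rfl⟩
      exact hi' (Finset.mem_map.2 ⟨j, by simpa [initial] using hi, rfl⟩)
  rw [← h, Finset.sum_map]
  simp [extendZero_inclusion]

theorem hasSum_extendZero_iff {X : Type*} [AddCommGroup X] [Module ℝ X] [TopologicalSpace X]
    (w : I → X) (x : X) :
    HasSum (fun i => extendZero hJ c i • w i) x (natOrder I) ↔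
      HasSum (fun i => c i • w (Set.inclusion hJ i)) x (natOrder J) := by
  simp only [hasSum_natOrder_iff, sum_initial_extendZero]

theorem extendZero_sq_comp :
    (fun i => extendZero hJ c i ^ 2) ∘ Set.inclusion hJ = fun i => c i ^ 2 := by
  ext i
  simp [extendZero_inclusion]

theorem summable_extendZero_sq_iff :
    (Summable fun i => extendZero hJ c i ^ 2) ↔ Summable fun i => c i ^ 2 := by
  rw [← extendZero_sq_comp hJ c]
  refine ((Set.inclusion_injective hJ).summable_iff fun i hi => ?_).symm
  simp [extendZero_of_notMem hJ c hi]

theorem tsum_extendZero_sq : ∑' i, extendZero hJ c i ^ 2 = ∑' i, c i ^ 2 := by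
  rw [← extendZero_sq_comp hJ c]
  refine ((Set.inclusion_injective hJ).tsum_eq fun i hi => ?_).symm
  by_contra h
  exact hi (by simp [extendZero_of_notMem hJ c h])

end Extend

/-- The Hilbert space of square-summable families. -/
abbrev L2 (J : Set ℕ) : Type := lp (fun _ : J => ℝ) 2

theorem memℓp_two_iff {J : Set ℕ} {c : J → ℝ} : Memℓp c 2 ↔ Summable fun i => c i ^ 2 := by
  rw [memℓp_gen_iff (by norm_num)]
  simp

theorem L2.norm_sq {J : Set ℕ} (c : L2 J) : ‖c‖ ^ 2 = ∑' i, c i ^ 2 := by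
  have := lp.norm_rpow_eq_tsum (p := 2) (by norm_num) c
  simpa using this

/-- The coordinate functionals on `ℓ²`. -/
def L2.coord {J : Set ℕ} (i : J) : StrongDual ℝ (L2 J) :=
  lp.evalCLM ℝ (fun _ : J => ℝ) 2 i

@[simp] theorem L2.coord_apply {J : Set ℕ} (i : J) (c : L2 J) : L2.coord i c = c i := rfl

/-- Restriction of square-summable families to a subset. -/
def L2.restrict {J₁ J₂ : Set ℕ} (h : J₂ ⊆ J₁) : L2 J₁ →L[ℝ] L2 J₂ :=
  LinearMap.mkContinuous
    ⟨⟨fun c => ⟨fun i => c (Set.inclusion h i), memℓp_two_iff.2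
      ((memℓp_two_iff.1 c.2).comp_injective (Set.inclusion_injective h))⟩,
      fun _ _ => rfl⟩, fun _ _ => rfl⟩ 1 fun c => by
    rw [one_mul]
    refine le_of_sq_le_sq ?_ (norm_nonneg _)
    rw [L2.norm_sq, L2.norm_sq]
    have hc := memℓp_two_iff.1 c.2
    exact Summable.tsum_le_tsum_of_inj _ (Set.inclusion_injective h) (fun i _ => sq_nonneg _)
      (fun i => le_rfl) (hc.comp_injective (Set.inclusion_injective h)) hc

@[simp] theorem L2.restrict_apply {J₁ J₂ : Set ℕ} (h : J₂ ⊆ J₁) (c : L2 J₁) (i : J₂) :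
    L2.restrict h c i = c (Set.inclusion h i) := rfl

section Equivalence

variable {I : Set ℕ} {F : Type*} [NormedAddCommGroup F] [NormedSpace ℝ F]

/-- A Hilbertian family has uniformly bounded partial sums on `ℓ²`. -/
theorem IsHilbertian.exists_bound {J : Set ℕ} {v : J → F} (hv : IsHilbertian v) :
    ∃ C : ℝ, 0 ≤ C ∧ ∀ (c : L2 J) N, ‖∑ i ∈ initial J N, c i • v i‖ ≤ C * ‖c‖ := by
  let S : ℕ → L2 J →L[ℝ] F := fun N => ∑ i ∈ initial J N, (L2.coord i).smulRight (v i)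
  have hS : ∀ N c, S N c = ∑ i ∈ initial J N, c i • v i := fun N c => by
    simp [S]
  -- Convergence for each `c` bounds the partial sum operators pointwise.
  obtain ⟨C, hC⟩ := banach_steinhaus (g := S) fun c => by
    obtain ⟨x, hx⟩ := hv c (memℓp_two_iff.1 c.2)
    obtain ⟨B, hB⟩ := (hasSum_natOrder_iff.1 hx).norm.bddAbove_range
    exact ⟨B, fun N => by rw [hS]; exact hB ⟨N, rfl⟩⟩
  refine ⟨C, (norm_nonneg _).trans (hC 0), fun c N => ?_⟩
  rw [← hS]
  exact (S N).le_of_opNorm_le (hC N) c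

/-- The synthesis map of a Besselian and Hilbertian basis is an isomorphism from `ℓ²`. -/
theorem OrderedBasis.exists_lower_bound [CompleteSpace F] (b : OrderedBasis I F)
    (hB : IsBesselian b.vec) (hH : IsHilbertian b.vec) :
    ∃ K : ℝ, 0 ≤ K ∧ ∀ (c : L2 I) x, HasSum (fun i => c i • b.vec i) x (natOrder I) →
      ‖c‖ ≤ K * ‖x‖ := by
  obtain ⟨C, hC0, hC⟩ := hH.exists_bound
  have hsum : ∀ c : L2 I, ∃ x, HasSum (fun i => c i • b.vec i) x (natOrder I) :=
    fun c => hH c (memℓp_two_iff.1 c.2)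
  choose Q hQ using hsum
  let Ql : L2 I →ₗ[ℝ] F :=
    { toFun := Q
      map_add' := fun c d => (hQ (c + d)).unique (by simpa [add_smul] using (hQ c).add (hQ d))
      map_smul' := fun r c => (hQ (r • c)).unique (by
        simpa [mul_smul] using (hQ c).const_smul r) }
  let Qc : L2 I →L[ℝ] F := Ql.mkContinuous C fun c =>
    le_of_tendsto (hasSum_natOrder_iff.1 (hQ c)).norm (Eventually.of_forall fun N => hC c N)
  have hQc : ∀ c, Qc c = Q c := fun _ => rfl
  have hinj : Qc.ker = ⊥ := by
    rw [LinearMap.ker_eq_bot']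
    intro c hc
    have h1 := hQ c
    rw [← hQc, show Qc c = 0 from hc] at h1
    ext i
    exact congrFun ((b.isSchauderBasis 0).unique h1 (y₂ := 0) (by simp)) i
  have hsurj : Qc.range = ⊤ := by
    rw [LinearMap.range_eq_top]
    intro x
    obtain ⟨a, ha, -⟩ := b.isSchauderBasis x
    let c : L2 I := ⟨a, memℓp_two_iff.2 (hB a ⟨x, ha⟩)⟩
    exact ⟨c, (hQ c).unique ha⟩
  -- Uniqueness of expansions gave injectivity and the Besselian property surjectivity; the open
  -- mapping theorem now bounds the inverse.
  let e := ContinuousLinearEquiv.ofBijective Qc hinj hsurj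
  refine ⟨‖(e.symm : F →L[ℝ] L2 I)‖, norm_nonneg _, fun c x hx => ?_⟩
  have : e c = x := (hQ c).unique hx
  rw [← this]
  simpa using (e.symm : F →L[ℝ] L2 I).le_opNorm (e c)

variable {J : Set ℕ} (b : OrderedBasis I F) (hJ : J ⊆ I)

theorem mem_coeffSubmodule_iff (hB : IsBesselian b.vec) (hH : IsHilbertian b.vec) {c : J → ℝ} :
    c ∈ coeffSubmodule b hJ ↔ Summable fun i => c i ^ 2 := by
  rw [← summable_extendZero_sq_iff hJ c]
  change (∃ x, _) ↔ _
  simp only [← hasSum_extendZero_iff hJ c b.vec]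
  exact ⟨fun h => hB _ h, fun h => hH _ h⟩

/-- If the basis is Besselian and Hilbertian, then `Y(J)` is isomorphic to `ℓ²(J)`. -/
theorem Y.exists_equiv_L2 [CompleteSpace F] (hB : IsBesselian b.vec) (hH : IsHilbertian b.vec) :
    ∃ e : Y b hJ ≃L[ℝ] L2 J, ∀ c i, e c i = c i := by
  have hmem := fun c => mem_coeffSubmodule_iff b hJ hB hH (c := c)
  obtain ⟨K, hK0, hK⟩ := b.exists_lower_bound hB hH
  have hHJ : IsHilbertian fun i => b.vec (Set.inclusion hJ i) := fun a ha => (hmem a).2 ha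
  obtain ⟨C, hC0, hC⟩ := hHJ.exists_bound
  let e : Y b hJ ≃ₗ[ℝ] L2 J :=
    { toFun := fun c => ⟨c.1, memℓp_two_iff.2 ((hmem c).1 c.2)⟩
      invFun := fun c => (⟨c, (hmem c).2 (memℓp_two_iff.1 c.2)⟩ : coeffSubmodule b hJ)
      left_inv := fun c => rfl
      right_inv := fun c => rfl
      map_add' := fun c d => rfl
      map_smul' := fun r c => rfl }
  refine ⟨e.toContinuousLinearEquivOfBounds K C (fun c => ?_) (fun c => ?_), fun c i => rfl⟩
  · obtain ⟨x, hx⟩ := c.2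
    have hsq := (hmem c).1 c.2
    let d : L2 I := ⟨extendZero hJ c.1, memℓp_two_iff.2 ((summable_extendZero_sq_iff hJ c).2 hsq)⟩
    have hd : ‖e c‖ = ‖d‖ := by
      rw [← sq_eq_sq₀ (norm_nonneg _) (norm_nonneg _), L2.norm_sq, L2.norm_sq]
      exact (tsum_extendZero_sq hJ c).symm
    have hxc : ‖x‖ ≤ ‖c‖ :=
      le_of_tendsto (hasSum_natOrder_iff.1 hx).norm
        (Eventually.of_forall fun N => c.norm_partialSum_le N)
    rw [hd]
    exact (hK d x ((hasSum_extendZero_iff hJ c b.vec x).2 hx)).trans (by gcongr)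
  · exact ciSup_le fun N => hC c N

end Equivalence

/-! ### Surjectivity from uniqueness of expansions -/

/-- A map `T` into `ℓ²` with closed range is onto if the family of its coordinates admits no
nontrivial expansion of zero with square-summable coefficients. -/
theorem surjective_of_isClosed_range {J : Set ℕ} {E : Type*} [NormedAddCommGroup E]
    [NormedSpace ℝ E] (T : E →L[ℝ] L2 J) (hT : IsClosed (Set.range T))
    (hun : ∀ w : L2 J, HasSum (fun i => w i • (L2.coord i).comp T) 0 (natOrder J) → w = 0) :
    Function.Surjective T := by
  classical
  have hcl : IsClosed (T.range : Set (L2 J)) := hT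
  have : CompleteSpace T.range := hcl.completeSpace_coe
  have : T.range.HasOrthogonalProjection := .ofCompleteSpace _
  rw [← ContinuousLinearMap.coe_coe, ← LinearMap.range_eq_top, ← Submodule.orthogonal_eq_bot_iff,
    Submodule.eq_bot_iff]
  intro w hw
  refine hun w (hasSum_natOrder_of_hasSum ?_)
  -- Push the expansion of `w` in unit vectors through the Riesz map and the adjoint of `T`; it then
  -- converges in the norm of the dual of `E`, to `⟪w, T ·⟫ = 0`.
  have h1 := ((lp.hasSum_single (p := 2) (by norm_num) w).mapL (innerSL ℝ)).mapL
    (ContinuousLinearMap.precomp ℝ T)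
  have h2 : ContinuousLinearMap.precomp ℝ T (innerSL ℝ w) = 0 := by
    ext e
    have := (Submodule.mem_orthogonal' _ w).1 hw (T e) ⟨e, rfl⟩
    simpa using this
  rw [h2] at h1
  convert h1 using 2 with i
  ext e
  simp [lp.inner_single_left, mul_comm]

end FunDep

end

/-! ### Reduction of the theorem to a submersion into `ℓ²` -/

theorem mainTheorem2 {E F : Type*}
    [NormedAddCommGroup E] [NormedSpace ℝ E] [CompleteSpace E]
    [NormedAddCommGroup F] [InnerProductSpace ℝ F] [CompleteSpace F]
    {I : Set ℕ} (b : FunDep.OrderedBasis I F)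
    (hBesselian : FunDep.IsBesselian b.vec) (hHilbertian : FunDep.IsHilbertian b.vec)
    {J₁ J₂ : Set ℕ} (h₁ : J₁ ⊆ I) (h₂ : J₂ ⊆ J₁)
    {U : Set E} (hU : IsOpen U) (f : E → FunDep.Y b h₁) (hf : ContDiffOn ℝ 1 f U)
    (x₀ : E) {V : Set E} (hVU : V ⊆ U) (hCRC : FunDep.CRCPlus f x₀ h₂ V) :
    ∃ h : ↥(J₁ \ J₂) → FunDep.Y b (h₂.trans h₁) → ℝ,
      (∀ l, ContDiff ℝ 1 (h l)) ∧
      ∀ᶠ x in 𝓝 x₀, ∃ c : FunDep.Y b (h₂.trans h₁),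
        (∀ i : J₂, c i = f x (Set.inclusion h₂ i)) ∧
        ∀ l : ↥(J₁ \ J₂), f x (Set.inclusion Set.sdiff_subset l) = h l c := by
  open FunDep in
  obtain ⟨e₁, he₁⟩ := Y.exists_equiv_L2 b h₁ hBesselian hHilbertian
  obtain ⟨e₂, he₂⟩ := Y.exists_equiv_L2 b (h₂.trans h₁) hBesselian hHilbertian
  have he₂' : ∀ w i, e₂.symm w i = w i := fun w i => by rw [← he₂, e₂.apply_symm_apply]
  let A : Y b h₁ →L[ℝ] L2 J₂ := (L2.restrict h₂).comp (e₁ : Y b h₁ →L[ℝ] L2 J₁)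
  let G : E → L2 J₂ := fun x => A (f x)
  have hGi : ∀ x (i : J₂), G x i = f x (Set.inclusion h₂ i) := fun x i => he₁ (f x) _
  have hfx : ∀ x ∈ V, ContDiffAt ℝ 1 f x := fun x hx => hf.contDiffAt (hU.mem_nhds (hVU hx))
  have hG : ∀ x ∈ V, ContDiffAt ℝ 1 G x := fun x hx => A.contDiff.contDiffAt.comp x (hfx x hx)
  have hφ : ∀ (j : J₁), ∀ x ∈ V, ContDiffAt ℝ 1 (fun y => f y j) x := fun j x hx => by
    simp only [← he₁]
    exact ((L2.coord j).comp (e₁ : Y b h₁ →L[ℝ] L2 J₁)).contDiff.contDiffAt.comp x (hfx x hx)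
  have hderiv : ∀ x ∈ V, ∀ i : J₂,
      coordDeriv f x (Set.inclusion h₂ i) = (L2.coord i).comp (fderiv ℝ G x) := fun x hx i => by
    have h := (L2.coord i).hasFDerivAt.comp x ((hG x hx).differentiableAt one_ne_zero).hasFDerivAt
    rw [← h.fderiv, coordDeriv]
    congr 1
    ext y
    exact (hGi y i).symm
  have hx₀ : x₀ ∈ V := mem_of_mem_nhds hCRC.mem_nhds
  have hker : ∀ l : ↥(J₁ \ J₂), ∀ x ∈ V, ∀ e, fderiv ℝ G x e = 0 →
      fderiv ℝ (fun y => f y (Set.inclusion Set.sdiff_subset l)) x e = 0 := by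
    intro l x hx e he
    let j : J₁ := Set.inclusion Set.sdiff_subset l
    obtain ⟨a, ha, -⟩ := hCRC.basis x hx ⟨_, mem_closedSpan (coordDeriv f x) j⟩
    have h1 := ha.mapL ((NormedSpace.inclusionInDoubleDual ℝ E e).comp
      (closedSpan (coordDeriv f x)).subtypeL)
    have h2 : ∀ i : J₂, coordDeriv f x (Set.inclusion h₂ i) e = 0 := fun i => by
      rw [hderiv x hx i]
      simp [he]
    simp only [subfamily, map_smul, ContinuousLinearMap.comp_apply, Submodule.subtypeL_apply,
      NormedSpace.dual_def, h2, smul_zero] at h1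
    exact h1.unique hasSum_zero
  have hsurj : Function.Surjective (fderiv ℝ G x₀) := by
    refine surjective_of_isClosed_range _ ?_ fun w hw => ?_
    -- Under `e₂` the range of `DG(x₀)` is the image that CRC+ assumes closed in `Y(J₂)`.
    · convert hCRC.isClosed_image.preimage e₂.symm.continuous using 1
      ext w
      simp only [Set.mem_range, Set.mem_preimage, Set.mem_ofPred_eq, he₂', hderiv x₀ hx₀]
      refine exists_congr fun e => ⟨?_, fun h => ?_⟩
      · rintro rfl i
        rfl
      · ext i
        exact (h i).symm
    · have h1 : HasSum (fun i => w i • subfamily (coordDeriv f x₀) h₂ i) 0 (natOrder J₂) := by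
        rw [hasSum_natOrder_iff] at hw ⊢
        rw [tendsto_subtype_rng]
        simpa [subfamily, hderiv x₀ hx₀] using hw
      ext i
      exact congrFun ((hCRC.basis x₀ hx₀ 0).unique h1 (y₂ := 0) (by simp)) i
  obtain ⟨ρ, hρ, k, hk, hkG⟩ := exists_contDiffOn_comp_eq
    (φ := fun (l : ↥(J₁ \ J₂)) y => f y (Set.inclusion Set.sdiff_subset l))
    hCRC.mem_nhds hG (fun l => hφ _) hsurj hker
  choose k' hk' hkk' using fun l => exists_contDiff_eq_on_ball hρ (hk l)
  refine ⟨fun l c => k' l (e₂ c), fun l => (hk' l).comp e₂.contDiff, ?_⟩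
  filter_upwards [hkG, (hG x₀ hx₀).continuousAt (Metric.ball_mem_nhds (G x₀)
    (show 0 < ρ / 3 by positivity))] with x hx hxρ
  refine ⟨e₂.symm (G x), fun i => by rw [he₂', hGi], fun l => ?_⟩
  rw [e₂.apply_symm_apply, hkk' l _ hxρ]
  exact hx l
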